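/- Let $G$ be a group. A subgroup $H \leqslant G$ is a virtual retract of $G$ if there is a subgroup $K \leqslant G$ of finite index such that $H \subseteq K$ and there is a homomorphism $\rho : K \to H$ with $\rho(h) = h$ for all $h \in H$. The group $G$ has property (VRC) if every cyclic subgroup of $G$ is a virtual retract of $G$. For groups $A$ and $B$, let $A^B$ be the group of all functions $f : B \to A$ with finite support, with pointwise multiplication. The restricted wreath product $A \wr B$ is the semidirect product $A^B \rtimes B$, where $b \in B$ acts on $f \in A^B$ by $(bfb^{-1})(x) = f(xb)$ for all $x \in B$. Theorem. Let $A$ and $B$ be groups and let $G = A \wr B$ be their restricted wreath product. Then $G$ has (VRC) if and only if both of the following conditions hold: (i) both $A$ and $B$ have (VRC); (ii) either $B$ is finite or $A$ is abelian. -/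

import Mathlib

/-- `H` is a retract of `K`: `H ≤ K` and some homomorphism `ρ : K → H` restricts to the identity
on `H`. -/
def IsRetractOf {G : Type*} [Group G] (H K : Subgroup G) : Prop :=
  ∃ (hHK : H ≤ K) (ρ : K →* H), ∀ h : H, ρ (Subgroup.inclusion hHK h) = h

/-- `H` is a virtual retract of `G`: it is a retract of a finite index subgroup of `G`. -/
def IsVirtualRetract {G : Type*} [Group G] (H : Subgroup G) : Prop :=
  ∃ K : Subgroup G, K.FiniteIndex ∧ IsRetractOf H K

/-- Property (VRC): every cyclic subgroup is a virtual retract. -/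
def HasVRC (G : Type*) [Group G] : Prop :=
  ∀ H : Subgroup G, IsCyclic H → IsVirtualRetract H

/-- The group of finitely supported functions `B → A`, under pointwise multiplication. -/
def wreathBase (A B : Type*) [Group A] : Subgroup (B → A) where
  carrier := {f | (Function.mulSupport f).Finite}
  one_mem' := by simp
  mul_mem' {f g} hf hg := (hf.union hg).subset (Function.mulSupport_mul f g)
  inv_mem' {f} hf := by
    change (Function.mulSupport f⁻¹).Finite
    rwa [Function.mulSupport_inv]

theorem translate_mem_wreathBase {A B : Type*} [Group A] [Group B] (b : B) {f : B → A}
    (hf : f ∈ wreathBase A B) : (fun x => f (x * b)) ∈ wreathBase A B :=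
  Set.Finite.preimage (fun _ _ _ _ h => mul_right_cancel h) hf

/-- The left action of `B` on the finitely supported functions `B → A` by automorphisms:
`(b • f) x = f (x * b)`. -/
def wreathAction (A B : Type*) [Group A] [Group B] : B →* MulAut (wreathBase A B) where
  toFun b :=
    { toFun := fun f => ⟨fun x => f.1 (x * b), translate_mem_wreathBase b f.2⟩
      invFun := fun f => ⟨fun x => f.1 (x * b⁻¹), translate_mem_wreathBase b⁻¹ f.2⟩
      left_inv := fun f => Subtype.ext (funext fun x => by simp)
      right_inv := fun f => Subtype.ext (funext fun x => by simp)
      map_mul' := fun _ _ => rfl }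
  map_one' := MulEquiv.ext fun f => Subtype.ext (funext fun x => by simp)
  map_mul' b c := MulEquiv.ext fun f => Subtype.ext (funext fun x => by simp [mul_assoc])

/-- The restricted wreath product `A ≀ B`: the semidirect product of the group of finitely
supported functions `B → A` with `B`, which acts by translation of the argument. -/
abbrev RestrictedWreathProduct (A B : Type*) [Group A] [Group B] : Type _ :=
  wreathBase A B ⋊[wreathAction A B] B

/-! By `hasVRC_iff`, (VRC) becomes a condition on elements: nontrivial ones are separated, and those
of infinite order are detected. Both properties pull back along homomorphisms, and detection of a
power of `g` gives detection of `g`, by transfer. Necessity: if `B` is infinite, each finite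
quotient of `A ≀ B` kills some `t ≠ 1` in `B`. This identifies copies of `A` at distinct
coordinates, which commute, so commutators in `A` die and residual finiteness forces `A` to be
abelian. Sufficiency: for finite `B`, the base has finite index and its coordinates map to `A`. For
abelian `A`, an element that `B` does not handle has a power in the base; a finite quotient `B ⧸ N`
injective on its support reduces to `A ≀ (B ⧸ N)`. -/

/-- `g` lies outside some finite index subgroup. -/
def IsSeparated {G : Type*} [Group G] (g : G) : Prop :=
  ∃ K : Subgroup G, K.FiniteIndex ∧ g ∉ K

/-- Some homomorphism to `ℤ` from a finite index subgroup containing `g` is nontrivial at `g`. -/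
def IsDetected {G : Type*} [Group G] (g : G) : Prop :=
  ∃ K : Subgroup G, K.FiniteIndex ∧ ∃ (φ : K →* Multiplicative ℤ) (h : g ∈ K), φ ⟨g, h⟩ ≠ 1

/-! ### Separation, detection and transfer -/

section Detection

variable {G G' : Type*} [Group G] [Group G']

theorem Subgroup.FiniteIndex.comap {K : Subgroup G'} (hK : K.FiniteIndex) (f : G →* G') :
    (K.comap f).FiniteIndex :=
  ⟨by rw [Subgroup.index_comap]; exact (Subgroup.isFiniteRelIndex_of_finiteIndex).1⟩

theorem Subgroup.FiniteIndex.map_subtype {L : Subgroup G} (hL : L.FiniteIndex) {K : Subgroup L}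
    (hK : K.FiniteIndex) : (K.map L.subtype).FiniteIndex :=
  ⟨by rw [Subgroup.index_map_subtype]; exact mul_ne_zero hK.1 hL.1⟩

theorem IsSeparated.of_map (f : G →* G') {g : G} (h : IsSeparated (f g)) : IsSeparated g := by
  obtain ⟨K, hK, hg⟩ := h
  exact ⟨K.comap f, hK.comap f, hg⟩

theorem IsSeparated.of_subgroup {L : Subgroup G} (hL : L.FiniteIndex) {g : L}
    (h : IsSeparated g) : IsSeparated (g : G) := by
  obtain ⟨K, hK, hg⟩ := h
  refine ⟨K.map L.subtype, hL.map_subtype hK, ?_⟩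
  rintro ⟨x, hx, hxg⟩
  exact hg (Subtype.ext hxg ▸ hx)

theorem IsDetected.of_map (f : G →* G') {g : G} (h : IsDetected (f g)) : IsDetected g := by
  obtain ⟨K, hK, φ, hg, hφ⟩ := h
  exact ⟨K.comap f, hK.comap f, φ.comp (f.subgroupComap K), hg, hφ⟩

theorem IsDetected.of_subgroup {L : Subgroup G} (hL : L.FiniteIndex) {g : L}
    (h : IsDetected g) : IsDetected (g : G) := by
  obtain ⟨K, hK, φ, hg, hφ⟩ := h
  refine ⟨K.map L.subtype, hL.map_subtype hK,
    φ.comp (K.equivMapOfInjective L.subtype L.subtype_injective).symm.toMonoidHom,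
    ⟨g, hg, rfl⟩, ?_⟩
  have : (K.equivMapOfInjective L.subtype L.subtype_injective).symm
      ⟨(g : G), ⟨g, hg, rfl⟩⟩ = ⟨g, hg⟩ := by
    rw [MulEquiv.symm_apply_eq]; rfl
  simpa [this] using hφ

theorem finiteIndex_zpowers_multiplicative_int {d : Multiplicative ℤ} (hd : d ≠ 1) :
    (Subgroup.zpowers d).FiniteIndex := by
  have h : (AddSubgroup.zmultiples (Multiplicative.toAdd d)).index ≠ 0 := by
    rw [Int.index_zmultiples]
    exact Int.natAbs_ne_zero.2 hd
  exact ⟨h⟩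

theorem IsDetected.isSeparated {g : G} (h : IsDetected g) : IsSeparated g := by
  obtain ⟨K, hK, φ, hg, hφ⟩ := h
  refine IsSeparated.of_subgroup hK (g := ⟨g, hg⟩) (IsSeparated.of_map φ ?_)
  -- A nonzero integer is not a multiple of its double.
  refine ⟨Subgroup.zpowers (φ ⟨g, hg⟩ ^ 2), finiteIndex_zpowers_multiplicative_int ?_, ?_⟩
  · simpa using hφ
  · rw [Subgroup.mem_zpowers_iff]
    rintro ⟨k, hk⟩
    generalize φ ⟨g, hg⟩ = d at hφ hk
    have h1 : k * (2 * Multiplicative.toAdd d) = Multiplicative.toAdd d := by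
      simpa using congrArg Multiplicative.toAdd hk
    have h2 : Multiplicative.toAdd d ≠ 0 := hφ
    have h3 : (k * 2) * Multiplicative.toAdd d = 1 * Multiplicative.toAdd d := by linarith
    have := mul_right_cancel₀ h2 h3
    omega

/-- A subgroup that embeds into a quotient of a finite index subgroup `L`, and whose image has a
preimage of finite index, is a virtual retract. -/
theorem isVirtualRetract_of_injective {C : Type*} [Group C] {H L : Subgroup G}
    (hL : L.FiniteIndex) (hHL : H ≤ L) (f : L →* C)
    (hf : Function.Injective (f.comp (Subgroup.inclusion hHL)))
    (hC : ((f.comp (Subgroup.inclusion hHL)).range.comap f).FiniteIndex) :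
    IsVirtualRetract H := by
  set j := f.comp (Subgroup.inclusion hHL) with hj
  have hK : (j.range.comap f).map L.subtype ≤ L := Subgroup.map_subtype_le _
  have hr : ∀ x : (j.range.comap f).map L.subtype,
      (f.comp (Subgroup.inclusion hK)) x ∈ j.range := by
    rintro ⟨_, y, hy, rfl⟩
    exact hy
  refine ⟨(j.range.comap f).map L.subtype, hL.map_subtype hC,
    fun h hh => ⟨⟨h, hHL hh⟩, ⟨⟨h, hh⟩, rfl⟩, rfl⟩,
    (MonoidHom.ofInjective hf).symm.toMonoidHom.comp
      ((f.comp (Subgroup.inclusion hK)).codRestrict _ hr), fun h => ?_⟩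
  change (MonoidHom.ofInjective hf).symm _ = h
  rw [MulEquiv.symm_apply_eq]
  rfl

theorem exists_normal_finiteIndex_of_isSeparated {T : Set G} (hT : T.Finite)
    (hsep : ∀ t ∈ T, t ≠ 1 → IsSeparated t) :
    ∃ N : Subgroup G, N.Normal ∧ N.FiniteIndex ∧ ∀ t ∈ T, t ∈ N → t = 1 := by
  have hsep' : ∀ t : T, ∃ K : Subgroup G, K.FiniteIndex ∧ ((t : G) ∈ K → (t : G) = 1) := by
    intro t
    by_cases h1 : (t : G) = 1
    · exact ⟨⊤, inferInstance, fun _ => h1⟩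
    · obtain ⟨K, hK, ht⟩ := hsep t t.2 h1
      exact ⟨K, hK, fun h => absurd h ht⟩
  choose K hK hKT using hsep'
  have := hT.to_subtype
  have : (⨅ t, K t).FiniteIndex := Subgroup.finiteIndex_iInf hK
  exact ⟨(⨅ t, K t).normalCore, inferInstance, inferInstance, fun t ht h =>
    hKT ⟨t, ht⟩ (Subgroup.mem_iInf.1 (Subgroup.normalCore_le _ h) ⟨t, ht⟩)⟩

/-- A normal subgroup of finite index meeting `H` trivially embeds `H` in a finite quotient, where
every subgroup has finite index. -/
theorem isVirtualRetract_of_finite {H : Subgroup G} [Finite H]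
    (hsep : ∀ h ∈ H, h ≠ 1 → IsSeparated h) : IsVirtualRetract H := by
  obtain ⟨N, _, _, hN⟩ := exists_normal_finiteIndex_of_isSeparated (Set.toFinite (H : Set G)) hsep
  refine isVirtualRetract_of_injective (L := ⊤) inferInstance le_top
    ((QuotientGroup.mk' N).comp (Subgroup.subtype ⊤)) ?_ ?_
  · rw [injective_iff_map_eq_one]
    intro h hh
    exact Subtype.ext (hN h h.2 ((QuotientGroup.eq_one_iff (h : G)).1 hh))
  · exact Subgroup.FiniteIndex.comap inferInstance _

/-- The transfer extends a homomorphism that is nontrivial at a power of `g`, from a normal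
subgroup of finite index to the whole group, so that it is nontrivial at `g`. -/
theorem exists_hom_int_ne_one {N : Subgroup G} [N.Normal] [N.FiniteIndex]
    (φ : N →* Multiplicative ℤ) (g : G) (hgen : ∀ x : G, ∃ k : ℤ, ∃ y ∈ N, x = g ^ k * y)
    {n : ℕ} (hn : g ^ n ∈ N) (hφ : φ ⟨g ^ n, hn⟩ ≠ 1) :
    ∃ ψ : G →* Multiplicative ℤ, ψ g ≠ 1 := by
  classical
  refine ⟨φ.transfer, fun h => ?_⟩
  let _ := N.fintypeQuotientOfFiniteIndex
  -- The transfer is a product over the orbits of `g` on `G ⧸ N`. By `hgen`, the conjugator can be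
  -- taken in `N`, where the abelian target ignores it. The orbit lengths sum to the index.
  have key : ∀ q : G ⧸ N, φ ⟨q.out⁻¹ * g ^ Function.minimalPeriod (g • ·) q * q.out,
      QuotientGroup.out_conj_pow_minimalPeriod_mem N g q⟩ ^ n =
        φ ⟨g ^ n, hn⟩ ^ Function.minimalPeriod (g • ·) q := by
    intro q
    obtain ⟨k, y, hy, hq⟩ := hgen q.out
    have e : q.out⁻¹ * g ^ Function.minimalPeriod (g • ·) q * q.out =
        y⁻¹ * g ^ Function.minimalPeriod (g • ·) q * y := by
      rw [hq]
      group
    have hm : g ^ Function.minimalPeriod (g • ·) q ∈ N := by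
      have h1 := QuotientGroup.out_conj_pow_minimalPeriod_mem N g q
      rw [e] at h1
      simpa [mul_assoc] using
        N.mul_mem (N.mul_mem hy h1) (N.inv_mem hy)
    have e2 : (⟨q.out⁻¹ * g ^ Function.minimalPeriod (g • ·) q * q.out,
      QuotientGroup.out_conj_pow_minimalPeriod_mem N g q⟩ : N) = ⟨y, hy⟩⁻¹ * ⟨_, hm⟩ * ⟨y, hy⟩ :=
      Subtype.ext e
    rw [e2, map_mul, map_mul, map_inv, mul_right_comm, inv_mul_cancel, one_mul, ← map_pow,
      ← map_pow]
    congr 1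
    ext
    simp [← pow_mul, mul_comm]
  have h2 := congrArg (· ^ n) h
  rw [MonoidHom.transfer_eq_prod_quotient_orbitRel_zpowers_quot] at h2
  simp only [one_pow, ← Finset.prod_pow] at h2
  rw [Finset.prod_congr rfl fun q _ => key q.out, Finset.prod_pow_eq_pow_sum,
    ← Subgroup.index_eq_sum_minimalPeriod] at h2
  exact hφ ((pow_eq_one_iff_left Subgroup.FiniteIndex.index_ne_zero).1 h2)

end Detection

/-! ### The elementwise criterion for (VRC) -/

section Criterion

variable {G G' : Type*} [Group G] [Group G']

theorem IsDetected.isVirtualRetract_zpowers {g : G} (h : IsDetected g) :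
    IsVirtualRetract (Subgroup.zpowers g) := by
  obtain ⟨L, hL, φ, hg, hφ⟩ := h
  have hHL : Subgroup.zpowers g ≤ L := by simpa using hg
  refine isVirtualRetract_of_injective hL hHL φ ?_ (Subgroup.FiniteIndex.comap ?_ φ)
  · rw [injective_iff_map_eq_one]
    rintro ⟨x, hx⟩ h1
    obtain ⟨k, rfl⟩ := Subgroup.mem_zpowers_iff.1 hx
    have h2 : φ ⟨g, hg⟩ ^ k = 1 := by
      rw [← map_zpow]
      exact h1
    have hk : k = 0 := by
      by_contra hk
      exact hφ ((IsMulTorsionFree.zpow_eq_one_iff_left hk).1 h2)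
    subst hk
    simp
  · have := finiteIndex_zpowers_multiplicative_int hφ
    refine Subgroup.finiteIndex_of_le (H := Subgroup.zpowers (φ ⟨g, hg⟩)) ?_
    rw [Subgroup.zpowers_le]
    exact ⟨⟨g, Subgroup.mem_zpowers g⟩, rfl⟩

/-- Inside `N ⊔ ⟨g⟩`, with `N` the normal core of `K`, every element is a power of `g` times an
element of `N`, as the transfer argument requires. -/
theorem IsDetected.of_pow {g : G} {n : ℕ} (h : IsDetected (g ^ n)) : IsDetected g := by
  obtain ⟨K, hK, φ, hg, hφ⟩ := h
  set N := K.normalCore with hN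
  set L := N ⊔ Subgroup.zpowers g with hLdef
  have hL : L.FiniteIndex := Subgroup.finiteIndex_of_le (le_sup_left : N ≤ L)
  have hgL : g ∈ L := (le_sup_right : _ ≤ L) (Subgroup.mem_zpowers g)
  have hm : (g ^ n) ^ N.index ∈ N := N.pow_index_mem _
  have hm' : (⟨g, hgL⟩ : L) ^ (n * N.index) ∈ N.subgroupOf L := by
    rw [Subgroup.mem_subgroupOf]
    simpa [pow_mul] using hm
  have hgen : ∀ x : L, ∃ k : ℤ, ∃ y ∈ N.subgroupOf L, x = (⟨g, hgL⟩ : L) ^ k * y := by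
    rintro ⟨x, hx⟩
    have hx' := hx
    rw [hLdef, sup_comm, Subgroup.mem_sup_of_normal_right] at hx'
    obtain ⟨z, hz, y, hy, rfl⟩ := hx'
    obtain ⟨k, rfl⟩ := Subgroup.mem_zpowers_iff.1 hz
    exact ⟨k, ⟨y, (le_sup_left : N ≤ L) hy⟩, hy, Subtype.ext (by simp)⟩
  let ι : N.subgroupOf L →* K :=
    ((L.subtype).comp (N.subgroupOf L).subtype).codRestrict K fun y => K.normalCore_le y.2
  obtain ⟨ψ, hψ⟩ := exists_hom_int_ne_one (φ.comp ι) (⟨g, hgL⟩ : L) hgen hm' (by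
    have e : ι ⟨_, hm'⟩ = ⟨g ^ n, hg⟩ ^ N.index := Subtype.ext (by simp [ι, pow_mul])
    rw [MonoidHom.comp_apply, e, map_pow]
    exact fun h => hφ ((pow_eq_one_iff_left Subgroup.FiniteIndex.index_ne_zero).1 h))
  exact IsDetected.of_subgroup hL (g := ⟨g, hgL⟩)
    (IsDetected.of_map ψ ⟨⊤, inferInstance, (⊤ : Subgroup _).subtype, trivial, hψ⟩)

/-- Property (VRC) means that the group is residually finite and that each element of infinite
order is detected by a homomorphism to `ℤ` from a finite index subgroup. -/
theorem hasVRC_iff : HasVRC G ↔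
    ∀ g : G, (g ≠ 1 → IsSeparated g) ∧ (¬ IsOfFinOrder g → IsDetected g) := by
  constructor
  · intro hG g
    obtain ⟨K, hK, hle, ρ, hρ⟩ := hG (Subgroup.zpowers g) inferInstance
    have hgK : g ∈ K := hle (Subgroup.mem_zpowers g)
    have hρg : ρ ⟨g, hgK⟩ = ⟨g, Subgroup.mem_zpowers g⟩ := hρ ⟨g, Subgroup.mem_zpowers g⟩
    have hdet : ¬ IsOfFinOrder g → IsDetected g := by
      intro hg
      have : Infinite (Subgroup.zpowers g) :=
        (infinite_zpowers.2 hg).to_subtype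
      let e := intCyclicMulEquiv (G := Subgroup.zpowers g)
      refine IsDetected.of_subgroup hK (g := ⟨g, hgK⟩) (IsDetected.of_map ρ (IsDetected.of_map
        e.symm.toMonoidHom ⟨⊤, inferInstance, (⊤ : Subgroup _).subtype, trivial, ?_⟩))
      intro h
      have h1 : ρ ⟨g, hgK⟩ = 1 := by
        simpa using h
      rw [hρg] at h1
      exact hg (by rw [show g = 1 from congrArg Subtype.val h1]; exact IsOfFinOrder.one)
    refine ⟨fun hg => ?_, hdet⟩
    by_cases hfin : IsOfFinOrder g
    · have : Finite (Subgroup.zpowers g) := finite_zpowers.2 hfin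
      refine IsSeparated.of_subgroup hK (g := ⟨g, hgK⟩) (IsSeparated.of_map ρ
        ⟨⊥, inferInstance, ?_⟩)
      rw [hρg, Subgroup.mem_bot]
      exact fun h => hg (congrArg Subtype.val h)
    · exact (hdet hfin).isSeparated
  · intro h H hH
    obtain ⟨g, rfl⟩ := Subgroup.isCyclic_iff_exists_zpowers_eq_top H |>.1 hH
    by_cases hg : IsOfFinOrder g
    · have : Finite (Subgroup.zpowers g) := finite_zpowers.2 hg
      exact isVirtualRetract_of_finite fun x _ hx => (h x).1 hx
    · exact ((h g).2 hg).isVirtualRetract_zpowers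

theorem HasVRC.of_injective (h : HasVRC G') {f : G →* G'} (hf : Function.Injective f) :
    HasVRC G := by
  rw [hasVRC_iff] at h ⊢
  exact fun g => ⟨fun hg => .of_map f ((h _).1 ((map_ne_one_iff f hf).2 hg)),
    fun hg => .of_map f ((h _).2 fun h' => hg ((hf.isOfFinOrder_iff).1 h'))⟩

end Criterion

/-! ### Necessity, and the case of finite `B` -/

section Wreath

variable {A B : Type*} [Group A]

/-- The function supported at `b` with value `a` there, as an element of the base group. -/
noncomputable def wreathSingle (b : B) : A →* wreathBase A B := by
  classical
  exact (MonoidHom.mulSingle (fun _ : B => A) b).codRestrict _ fun a =>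
    (Set.finite_singleton b).subset Pi.mulSupport_mulSingle_subset

theorem wreathSingle_injective (b : B) :
    Function.Injective (wreathSingle b : A →* wreathBase A B) := fun x y h => by
  classical
  exact Pi.mulSingle_injective b (congrArg Subtype.val h)

theorem commute_wreathSingle {b c : B} (h : b ≠ c) (x y : A) :
    Commute (wreathSingle b x) (wreathSingle c y) := by
  classical
  exact Subtype.ext (Pi.mulSingle_commute (f := fun _ : B => A) h x y)

variable [Group B]

theorem wreathAction_wreathSingle (b c : B) (a : A) :
    wreathAction A B b (wreathSingle c a) = wreathSingle (c * b⁻¹) a := by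
  classical
  refine Subtype.ext (funext fun x => ?_)
  change (Pi.mulSingle c a : B → A) (x * b) = (Pi.mulSingle (c * b⁻¹) a : B → A) x
  simp only [Pi.mulSingle_apply, eq_mul_inv_iff_mul_eq]

/-- If `A ≀ B` is residually finite, then `B` is finite or `A` is abelian. -/
theorem finite_or_commute_of_isSeparated
    (h : ∀ g : RestrictedWreathProduct A B, g ≠ 1 → IsSeparated g) :
    Finite B ∨ ∀ x y : A, x * y = y * x := by
  by_contra hcon
  push Not at hcon
  obtain ⟨hB, x, y, hxy⟩ := hcon
  have : Infinite B := not_finite_iff_infinite.1 (by simpa using hB)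
  let i : A →* RestrictedWreathProduct A B := SemidirectProduct.inl.comp (wreathSingle 1)
  have hi : Function.Injective i :=
    SemidirectProduct.inl_injective.comp (wreathSingle_injective 1)
  obtain ⟨K, hK, hnot⟩ := h (i (x * y * (y * x)⁻¹)) (by
    rw [Ne, map_eq_one_iff i hi, mul_inv_eq_one]
    exact hxy)
  let π := QuotientGroup.mk' K.normalCore
  obtain ⟨b, c, hbc, hπ⟩ := Finite.exists_ne_map_eq_of_infinite
    fun b : B => π (SemidirectProduct.inr b)
  have hconj : ∀ b : B, π (SemidirectProduct.inr b) * π (i x) * (π (SemidirectProduct.inr b))⁻¹ =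
      π (SemidirectProduct.inl (wreathSingle b⁻¹ x)) := by
    intro b
    rw [← map_mul, ← map_inv, ← map_mul, ← map_inv]
    congr 1
    change _ * SemidirectProduct.inl _ * _ = _
    rw [← SemidirectProduct.inl_aut, wreathAction_wreathSingle, one_mul]
  let t := b⁻¹ * c
  have ht : π (SemidirectProduct.inr t) = 1 := by
    simp only [t, map_mul, map_inv] at hπ ⊢
    rw [← hπ, inv_mul_cancel]
  -- As `t` dies, conjugating by it moves `x` to coordinate `t⁻¹` without changing its image; there
  -- it commutes with `y` at coordinate `1`.
  have hx : π (i x) = π (SemidirectProduct.inl (wreathSingle t⁻¹ x)) := by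
    rw [← hconj t, ht]
    simp
  have ht1 : t⁻¹ ≠ 1 := by
    simpa [t, inv_mul_eq_one] using hbc.symm
  refine hnot (K.normalCore_le ((QuotientGroup.eq_one_iff _).1 ?_))
  change π (i (x * y * (y * x)⁻¹)) = 1
  rw [map_mul, map_mul, map_inv, map_inv, mul_inv_eq_one, map_mul, map_mul, map_mul, map_mul, hx]
  exact ((commute_wreathSingle ht1 x y).map SemidirectProduct.inl).map π

/-- The base group has finite index in the wreath product if `B` is finite. -/
theorem hasVRC_wreath_of_finite [Finite B] (hA : HasVRC A) :
    HasVRC (RestrictedWreathProduct A B) := by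
  rw [hasVRC_iff] at hA ⊢
  have hfi : (SemidirectProduct.rightHom : RestrictedWreathProduct A B →* B).ker.FiniteIndex :=
    inferInstance
  let ev (x : B) : (SemidirectProduct.rightHom : RestrictedWreathProduct A B →* B).ker →* A :=
    { toFun := fun g => g.1.left.1 x
      map_one' := rfl
      map_mul' := by
        rintro ⟨g, hg⟩ ⟨h, hh⟩
        have hg' : g.right = 1 := hg
        simp [hg'] }
  have hev : ∀ g, (∀ x, ev x g = 1) → g = 1 := fun g hg =>
    Subtype.ext (SemidirectProduct.ext (Subtype.ext (funext hg)) g.2)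
  refine fun g => ⟨fun hg => ?_, fun hg => ?_⟩
  · by_cases hk : g ∈ (SemidirectProduct.rightHom : RestrictedWreathProduct A B →* B).ker
    · refine IsSeparated.of_subgroup hfi (g := ⟨g, hk⟩) ?_
      obtain ⟨x, hx⟩ : ∃ x, ev x ⟨g, hk⟩ ≠ 1 := by
        by_contra! hcon
        exact hg (congrArg Subtype.val (hev _ hcon))
      exact IsSeparated.of_map (ev x) ((hA _).1 hx)
    · exact ⟨_, hfi, hk⟩
  · obtain ⟨n, hn, hk⟩ : ∃ n, 0 < n ∧ g ^ n ∈
        (SemidirectProduct.rightHom : RestrictedWreathProduct A B →* B).ker :=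
      ⟨_, Nat.pos_of_ne_zero hfi.1, Subgroup.pow_index_mem _ g⟩
    refine IsDetected.of_pow (n := n) (IsDetected.of_subgroup hfi (g := ⟨g ^ n, hk⟩) ?_)
    obtain ⟨x, hx⟩ : ∃ x, ¬ IsOfFinOrder (ev x ⟨g ^ n, hk⟩) := by
      by_contra! hcon
      have := Fintype.ofFinite B
      refine hg ((IsOfFinOrder.of_pow · hn.ne') ?_)
      -- As `B` is finite, one exponent kills all coordinates.
      refine isOfFinOrder_iff_pow_eq_one.2 ⟨∏ x, orderOf (ev x ⟨g ^ n, hk⟩),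
        Finset.prod_pos fun x _ => (hcon x).orderOf_pos, ?_⟩
      refine congrArg Subtype.val (hev (⟨g ^ n, hk⟩ ^ _) fun x => ?_)
      rw [map_pow]
      exact orderOf_dvd_iff_pow_eq_one.1 (Finset.dvd_prod_of_mem _ (Finset.mem_univ x))
    exact IsDetected.of_map (ev x) ((hA _).2 hx)

end Wreath

/-! ### Abelian `A`: reduction to finite quotients of `B` -/

section AbelianBase

variable {A B Q : Type*} [CommGroup A] [Finite Q]

/-- Multiplication of the values of a finitely supported function along the fibres of `π`. -/
noncomputable def wreathBaseMap (π : B → Q) : wreathBase A B →* wreathBase A Q where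
  toFun f := ⟨fun q => ∏ᶠ x ∈ π ⁻¹' {q}, f.1 x, Set.toFinite _⟩
  map_one' := Subtype.ext (funext fun _ => finprod_mem_one _)
  map_mul' f g := Subtype.ext (funext fun _ =>
    finprod_mem_mul_distrib' (f.2.inter_of_right _) (g.2.inter_of_right _))

/-- Each fibre meets `S` at most once, so the product over the fibre of a point of `S` is the value
of `f` there. -/
theorem wreathBaseMap_eq_one {π : B → Q} {S : Set B} (hπ : S.InjOn π) {f : wreathBase A B}
    (hf : Function.mulSupport f.1 ⊆ S) (h : wreathBaseMap π f = 1) : f = 1 := by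
  refine Subtype.ext (funext fun x => ?_)
  by_contra hx
  have hxS : x ∈ S := hf hx
  have h1 : ∏ᶠ y ∈ π ⁻¹' {π x}, f.1 y = 1 := congrFun (congrArg Subtype.val h) (π x)
  rw [finprod_mem_def, finprod_eq_single _ x] at h1
  · exact hx (by simpa using h1)
  · intro y hy
    rw [Set.mulIndicator_apply_eq_one]
    intro hyx
    by_contra hfy
    exact hy (hπ (hf hfy) hxS hyx)

/-- The homomorphism of wreath products induced by a homomorphism of the acting groups. -/
noncomputable def wreathMap [Group B] [Group Q] (π : B →* Q) :
    RestrictedWreathProduct A B →* RestrictedWreathProduct A Q :=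
  SemidirectProduct.map (wreathBaseMap π) π fun b => by
    refine MonoidHom.ext fun f => Subtype.ext (funext fun q => ?_)
    change ∏ᶠ x ∈ π ⁻¹' {q}, f.1 (x * b) = ∏ᶠ x ∈ π ⁻¹' {q * π b}, f.1 x
    refine finprod_mem_eq_of_bijOn (· * b) ⟨fun x hx => ?_, (mul_left_injective b).injOn,
      fun y hy => ⟨y * b⁻¹, ?_, by simp⟩⟩ fun _ _ => rfl
    · simpa using hx
    · have hy' : π y = q * π b := hy
      simp [hy']

theorem hasVRC_wreath_of_commGroup (hA : HasVRC A) {B : Type*} [Group B] (hB : HasVRC B) :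
    HasVRC (RestrictedWreathProduct A B) := by
  have hB' := hasVRC_iff.1 hB
  let r : RestrictedWreathProduct A B →* B := SemidirectProduct.rightHom
  -- Powers of `f` are supported in the support of `f`, so one `N` serves every `n` and infinite
  -- order survives in the quotient.
  have key : ∀ f : wreathBase A B, ∃ (N : Subgroup B) (_ : N.Normal) (_ : N.FiniteIndex),
      ∀ n : ℕ, wreathMap (QuotientGroup.mk' N)
        (SemidirectProduct.inl f ^ n : RestrictedWreathProduct A B) = 1 →
          (SemidirectProduct.inl f : RestrictedWreathProduct A B) ^ n = 1 := by
    intro f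
    have hT : (Set.image2 (fun x y => x⁻¹ * y) (Function.mulSupport f.1)
      (Function.mulSupport f.1)).Finite := f.2.image2 _ f.2
    obtain ⟨N, hN, hfi, hNT⟩ := exists_normal_finiteIndex_of_isSeparated hT
      fun t _ => (hB' t).1
    refine ⟨N, hN, hfi, fun n h => ?_⟩
    rw [← map_pow] at h ⊢
    rw [wreathMap, SemidirectProduct.map_inl,
      map_eq_one_iff _ SemidirectProduct.inl_injective] at h
    rw [map_eq_one_iff _ SemidirectProduct.inl_injective]
    refine wreathBaseMap_eq_one (S := Function.mulSupport f.1) (fun x hx y hy hxy => ?_)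
      (fun x hx => ?_) h
    · exact inv_mul_eq_one.1 (hNT _ ⟨x, hx, y, hy, rfl⟩ (QuotientGroup.eq.1 hxy))
    · intro hfx
      apply hx
      change f.1 x ^ n = 1
      rw [hfx, one_pow]
  have hinl : ∀ g : RestrictedWreathProduct A B, r g = 1 → SemidirectProduct.inl g.left = g :=
    fun g hg => SemidirectProduct.ext rfl hg.symm
  rw [hasVRC_iff]
  refine fun g => ⟨fun hg => ?_, fun hg => ?_⟩
  · by_cases hr : r g = 1
    · rw [← hinl g hr] at hg ⊢
      obtain ⟨N, _, _, hN⟩ := key g.left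
      refine IsSeparated.of_map (wreathMap (QuotientGroup.mk' N))
        ((hasVRC_iff.1 (hasVRC_wreath_of_finite hA) _).1 fun h => hg ?_)
      simpa using hN 1 (by simpa using h)
    · exact IsSeparated.of_map r ((hB' _).1 hr)
  · by_cases hr : IsOfFinOrder (r g)
    · obtain ⟨m, hm, hrm⟩ := isOfFinOrder_iff_pow_eq_one.1 hr
      refine IsDetected.of_pow (n := m) ?_
      have hgm : ¬ IsOfFinOrder (g ^ m) := fun h => hg (h.of_pow hm.ne')
      rw [← map_pow] at hrm
      rw [← hinl _ hrm] at hgm ⊢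
      obtain ⟨N, _, _, hN⟩ := key (g ^ m).left
      refine IsDetected.of_map (wreathMap (QuotientGroup.mk' N))
        ((hasVRC_iff.1 (hasVRC_wreath_of_finite hA) _).2 fun h => hgm ?_)
      obtain ⟨k, hk, h1⟩ := isOfFinOrder_iff_pow_eq_one.1 h
      exact isOfFinOrder_iff_pow_eq_one.2 ⟨k, hk, hN k (by rw [map_pow, h1])⟩
    · exact IsDetected.of_map r ((hB' _).2 hr)

end AbelianBase

theorem mainTheorem10 {A : Type*} {B : Type*} [Group A] [Group B] :
    HasVRC (RestrictedWreathProduct A B) ↔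
      (HasVRC A ∧ HasVRC B) ∧ (Finite B ∨ ∀ x y : A, x * y = y * x) := by
  constructor
  · intro h
    exact ⟨⟨h.of_injective (f := SemidirectProduct.inl.comp (wreathSingle 1))
        (SemidirectProduct.inl_injective.comp (wreathSingle_injective 1)),
      h.of_injective SemidirectProduct.inr_injective⟩,
      finite_or_commute_of_isSeparated fun g => (hasVRC_iff.1 h g).1⟩
  · rintro ⟨⟨hA, hB⟩, hfin | hcomm⟩
    · exact hasVRC_wreath_of_finite hA
    · let _ : CommGroup A := { ‹Group A› with mul_comm := hcomm }
      exact hasVRC_wreath_of_commGroup hA hB
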